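/- All graphs are finite, simple and undirected. A $k$-star coloring of a graph $G$ is an assignment of colors from $\{1,\dots,k\}$ to the vertices of $G$ such that adjacent vertices receive different colors and every path on four vertices in $G$ (as a subgraph, not necessarily induced) receives at least three distinct colors. The star chromatic number $\chi_s(G)$ is the smallest integer $k$ such that $G$ has a $k$-star coloring. The tensor product $G\times H$ has vertex set $V(G)\times V(H)$, and $(u,v)$ is adjacent to $(u',v')$ if and only if $uu'\in E(G)$ and $vv'\in E(H)$. Let $C_n$ denote the cycle on $n$ vertices. Theorem (tensor product of two cycles). For every pair of positive integers $m$ and $n$ with $3\le m\le n$, \[ \chi_s(C_m\times C_n)=\begin{cases}6, & \text{if } m=3 \text{ and } n\in\{3,5\},\\ 5, & \text{otherwise.}\end{cases} \] -/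

import Mathlib

namespace SimpleGraph

/-- The tensor (direct, categorical) product of two simple graphs: `(u, v)` and `(u', v')` are
adjacent iff `u` is adjacent to `u'` in `G` and `v` is adjacent to `v'` in `H`. -/
def tensorProd {V W : Type*} (G : SimpleGraph V) (H : SimpleGraph W) : SimpleGraph (V × W) where
  Adj x y := G.Adj x.1 y.1 ∧ H.Adj x.2 y.2
  symm.symm _ _ h := ⟨h.1.symm, h.2.symm⟩
  loopless.irrefl _ h := G.irrefl h.1

/-- A proper colouring with `k` colours is a star colouring if every path on four (distinct)
vertices `a, b, c, d` receives at least three distinct colours. The path need not be induced. -/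
def IsStarColoring {V : Type*} (G : SimpleGraph V) {k : ℕ} (f : G.Coloring (Fin k)) : Prop :=
  ∀ a b c d : V, [a, b, c, d].Nodup → G.Adj a b → G.Adj b c → G.Adj c d →
    3 ≤ ({f a, f b, f c, f d} : Finset (Fin k)).card

/-- `G` has a star colouring with colours from a set of `k` colours. -/
def StarColorable {V : Type*} (G : SimpleGraph V) (k : ℕ) : Prop :=
  ∃ f : G.Coloring (Fin k), G.IsStarColoring f

/-- The least `k` such that `G` has a star colouring with `k` colours
(`⊤` if there is no such natural number `k`). -/
noncomputable def starChromaticNumber {V : Type*} (G : SimpleGraph V) : ℕ∞ :=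
  ⨅ (k : ℕ) (_ : G.StarColorable k), (k : ℕ∞)

end SimpleGraph

/-! Star colouring is a local condition: it only concerns walks on four vertices that do not turn
back (`isStarColoring_iff`). For the upper bounds, let each cycle wind round a small digraph of
loops through one vertex. A table of colours on pairs of digraph vertices then colours the product,
and one finite check serves all lengths that are sums of loop lengths (`starColorable_of_table`). A
few tables cover every case.

For the lower bounds, a star colouring pulls back along homomorphisms that keep distinct points two
steps apart distinct, such as the map from the product of two paths onto the product of the cycles.
Hence one 4 × 4 patch with no 4-star colouring excludes four colours for all m and n. For five
colours, C₃ × C₃ and C₃ × C₅ are searched whole. -/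

namespace SimpleGraph

/-! ### Star colourings as a local condition, and their transport -/

section StarColoring

variable {V W : Type*} {G : SimpleGraph V} {H : SimpleGraph W} {k l : ℕ}

/-- A proper colouring is a star colouring iff it has no two-coloured walk on four vertices that
does not turn back. -/
theorem isStarColoring_iff (f : G.Coloring (Fin k)) :
    G.IsStarColoring f ↔ ∀ a b c d : V, G.Adj a b → G.Adj b c → G.Adj c d → a ≠ c → b ≠ d →
      f a = f c → f b ≠ f d := by
  constructor
  · intro h a b c d hab hbc hcd hac hbd h1 h2
    have had : a ≠ d := by
      rintro rfl
      exact f.valid hcd h1.symm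
    have h3 := h a b c d (by simp [hab.ne, hac, had, hbc.ne, hbd, hcd.ne]) hab hbc hcd
    have h4 : ({f a, f b, f c, f d} : Finset (Fin k)) = {f a, f b} := by
      rw [← h1, ← h2]
      ext x
      simp only [Finset.mem_insert, Finset.mem_singleton]
      tauto
    rw [h4] at h3
    have := Finset.card_le_two (a := f a) (b := f b)
    omega
  · intro h a b c d hn hab hbc hcd
    simp only [List.nodup_cons, List.mem_cons, not_or] at hn
    by_cases h1 : f a = f c
    · have h2 := h a b c d hab hbc hcd hn.1.2.1 hn.2.1.2.1 h1
      rw [← Finset.card_eq_three.2 ⟨f b, f c, f d, f.valid hbc, h2, f.valid hcd, rfl⟩]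
      exact Finset.card_le_card (by intro x; simp; tauto)
    · rw [← Finset.card_eq_three.2 ⟨f a, f b, f c, f.valid hab, h1, f.valid hbc, rfl⟩]
      exact Finset.card_le_card (by intro x; simp; tauto)

theorem StarColorable.comap (φ : G →g H) (hφ : Function.Injective φ) (h : H.StarColorable k) :
    G.StarColorable k := by
  obtain ⟨f, hf⟩ := h
  refine ⟨f.comp φ, (isStarColoring_iff _).2 fun a b c d hab hbc hcd hac hbd ↦ ?_⟩
  exact (isStarColoring_iff f).1 hf _ _ _ _ (φ.map_adj hab) (φ.map_adj hbc) (φ.map_adj hcd)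
    (hφ.ne hac) (hφ.ne hbd)

theorem StarColorable.mono (h : G.StarColorable k) (hkl : k ≤ l) : G.StarColorable l := by
  obtain ⟨f, hf⟩ := h
  refine ⟨Coloring.mk (fun v ↦ Fin.castLE hkl (f v)) fun hab he ↦
    f.valid hab (Fin.castLE_injective hkl he),
    (isStarColoring_iff _).2 fun a b c d hab hbc hcd hac hbd h1 h2 ↦ ?_⟩
  exact (isStarColoring_iff f).1 hf a b c d hab hbc hcd hac hbd
    (Fin.castLE_injective hkl h1) (Fin.castLE_injective hkl h2)

theorem starChromaticNumber_eq_succ (h : G.StarColorable (k + 1)) (h' : ¬ G.StarColorable k) :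
    G.starChromaticNumber = (k + 1 : ℕ) := by
  refine le_antisymm (iInf₂_le _ h) (le_iInf₂ fun j hj ↦ ?_)
  by_contra hlt
  exact h' (hj.mono (by
    have := not_le.1 hlt
    rw [Nat.cast_lt] at this
    omega))

theorem StarColorable.tensorProd_comm (h : (G.tensorProd H).StarColorable k) :
    (H.tensorProd G).StarColorable k :=
  h.comap (φ := ⟨Prod.swap, fun {_ _} h ↦ And.intro h.2 h.1⟩) Prod.swap_injective

end StarColoring

theorem cycleGraph_adj_iff_mod {m : ℕ} (hm : 3 ≤ m) (u v : Fin m) :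
    (cycleGraph m).Adj u v ↔ (u.val + 1) % m = v.val ∨ (v.val + 1) % m = u.val := by
  obtain ⟨m, rfl⟩ : ∃ j, m = j + 2 := ⟨m - 2, by omega⟩
  have key (x y : Fin (m + 2)) : x - y = 1 ↔ (y.val + 1) % (m + 2) = x.val := by
    rw [sub_eq_iff_eq_add, Fin.ext_iff, Fin.val_add, Fin.val_one, add_comm 1 y.val, eq_comm]
  rw [cycleGraph_adj, key, key, or_comm]

/-! ### Colourings from tables over digraphs -/

/-- There is a closed walk of length `m` based at `0` along the arcs in the list `E`. -/
def HasClosedWalk (E : List (ℕ × ℕ)) (m : ℕ) : Prop :=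
  ∃ w : ℕ → ℕ, w 0 = 0 ∧ w m = 0 ∧ ∀ i < m, (w i, w (i + 1)) ∈ E

theorem HasClosedWalk.add {E : List (ℕ × ℕ)} {m n : ℕ} (hm : HasClosedWalk E m)
    (hn : HasClosedWalk E n) : HasClosedWalk E (m + n) := by
  obtain ⟨v, hv0, hvm, hv⟩ := hm
  obtain ⟨w, hw0, hwn, hw⟩ := hn
  refine ⟨fun i ↦ if i < m then v i else w (i - m), ?_, by simp [hwn], fun i hi ↦ ?_⟩
  · rcases Nat.eq_zero_or_pos m with rfl | h
    · simp [hw0]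
    · simp [h, hv0]
  · rcases lt_trichotomy (i + 1) m with h | h | h
    · simpa [h, (Nat.lt_succ_self i).trans h] using hv i (by omega)
    · have := hv i (by omega)
      rw [h, hvm] at this
      simpa [h, show i < m by omega, hw0] using this
    · have := hw (i - m) (by omega)
      rw [show i - m + 1 = i + 1 - m by omega] at this
      simpa [show ¬ i < m by omega, show ¬ i + 1 < m by omega] using this

/-- The arcs of the directed cycles listed in `L`. -/
def loopArcs (L : List (List ℕ)) : List (ℕ × ℕ) :=
  L.flatMap fun l ↦ l.zip (l.rotate 1)

/-- Just past the end of `l`, `getD` returns its default `0`, which is the base vertex; so the last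
index accounts for the closing arc. -/
theorem hasClosedWalk_of_loop {E : List (ℕ × ℕ)} (l : List ℕ) (h0 : l.getD 0 0 = 0)
    (h : ∀ i < l.length, (l.getD i 0, l.getD (i + 1) 0) ∈ E) : HasClosedWalk E l.length :=
  ⟨fun i ↦ l.getD i 0, h0, by simp, h⟩

/-- The arcs in `E` in both directions. -/
def arcSteps (E : List (ℕ × ℕ)) : List (ℕ × ℕ) :=
  E.flatMap fun e ↦ [e, (e.2, e.1)]

/-- Two consecutive steps along arcs in `E`: either both in the same direction, or forth and back
along the same arc. The Boolean tells whether the walk turns back. -/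
def arcTurns (E : List (ℕ × ℕ)) : List (ℕ × ℕ × ℕ × Bool) :=
  E.flatMap fun e ↦ (e.1, e.2, e.1, true) :: (e.2, e.1, e.2, true) ::
    (E.filter fun e' ↦ e'.1 == e.2).flatMap fun e' ↦
      [(e.1, e.2, e'.2, false), (e'.2, e.2, e.1, false)]

/-- The table `F` uses colours less than `k` and gives a star colouring of each product of two
closed walks along arcs in `E₁` and `E₂`. -/
def isStarTable (k : ℕ) (F : ℕ → ℕ → ℕ) (E₁ E₂ : List (ℕ × ℕ)) : Bool :=
  ((arcSteps E₁).all fun e ↦ (arcSteps E₂).all fun e' ↦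
    Nat.blt (F e.1 e'.1) k && !Nat.beq (F e.1 e'.1) (F e.2 e'.2)) &&
  (arcTurns E₁).all fun s ↦ (arcTurns E₂).all fun s' ↦
    (s.2.2.2 && s'.2.2.2) || !Nat.beq (F s.1 s'.1) (F s.2.2.1 s'.2.2.1) ||
      (arcTurns E₁).all fun t ↦ !Nat.beq t.1 s.2.1 || !Nat.beq t.2.1 s.2.2.1 ||
        (arcTurns E₂).all fun t' ↦ !Nat.beq t'.1 s'.2.1 || !Nat.beq t'.2.1 s'.2.2.1 ||
          (t.2.2.2 && t'.2.2.2) || !Nat.beq (F s.2.1 s'.2.1) (F t.2.2.1 t'.2.2.1)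

section Table

variable {k : ℕ} {F : ℕ → ℕ → ℕ} {E₁ E₂ : List (ℕ × ℕ)}

theorem isStarTable.step (h : isStarTable k F E₁ E₂ = true) {x y x' y' : ℕ}
    (hx : (x, y) ∈ arcSteps E₁) (hx' : (x', y') ∈ arcSteps E₂) :
    F x x' < k ∧ F x x' ≠ F y y' := by
  simp only [isStarTable, Bool.and_eq_true, List.all_eq_true] at h
  simpa [← Bool.not_eq_true, Nat.beq_eq] using h.1 _ hx _ hx'

theorem isStarTable.turn (h : isStarTable k F E₁ E₂ = true) {x y z t x' y' z' t' : ℕ}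
    {p q p' q' : Bool} (h₁ : (x, y, z, p) ∈ arcTurns E₁) (h₂ : (x', y', z', p') ∈ arcTurns E₂)
    (h₃ : (y, z, t, q) ∈ arcTurns E₁) (h₄ : (y', z', t', q') ∈ arcTurns E₂)
    (hp : (p && p') = false) (hq : (q && q') = false) (hF : F x x' = F z z') :
    F y y' ≠ F t t' := by
  simp only [isStarTable, Bool.and_eq_true, List.all_eq_true] at h
  have h5 := h.2 _ h₁ _ h₂
  simp only [hp, hF, Nat.beq_refl, Bool.not_true, Bool.or_self, Bool.false_or,
    List.all_eq_true] at h5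
  have h6 := h5 _ h₃
  simp only [Nat.beq_refl, Bool.not_true, Bool.or_self, Bool.false_or, List.all_eq_true] at h6
  have h7 := h6 _ h₄
  simpa [hq, ← Bool.not_eq_true, Nat.beq_eq] using h7

variable {m : ℕ} {w : ℕ → ℕ} {E : List (ℕ × ℕ)}

theorem mem_arcSteps_of_adj (hm : 3 ≤ m) (hw : ∀ i < m, (w i, w ((i + 1) % m)) ∈ E)
    {i j : Fin m} (h : (cycleGraph m).Adj i j) : (w i, w j) ∈ arcSteps E := by
  rw [arcSteps, List.mem_flatMap]
  rcases (cycleGraph_adj_iff_mod hm i j).1 h with h | h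
  · exact ⟨_, hw i i.2, by simp [h]⟩
  · exact ⟨_, hw j j.2, by simp [h]⟩

/-- A position has only its predecessor and successor as neighbours, so a walk that reverses
direction retraces the arc it just used. The flag compares positions on the cycle, not labels. -/
theorem mem_arcTurns_of_adj (hm : 3 ≤ m) (hw : ∀ i < m, (w i, w ((i + 1) % m)) ∈ E)
    {i j l : Fin m} (hij : (cycleGraph m).Adj i j) (hjl : (cycleGraph m).Adj j l) :
    (w i, w j, w l, decide (i = l)) ∈ arcTurns E := by
  -- `omega` cannot treat `% m` for a variable `m`, so wrapping round is split off by hand.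
  have succ_cases (x : Fin m) : (x.val + 1) % m = x.val + 1 ∨ x.val + 1 = m ∧ (x.val + 1) % m = 0 := by
    rcases Nat.lt_or_ge (x.val + 1) m with h | h
    · exact .inl (Nat.mod_eq_of_lt h)
    · have : x.val + 1 = m := by omega
      exact .inr ⟨this, by simp [this]⟩
  rw [arcTurns, List.mem_flatMap]
  have hi := hw i i.2
  have hj := hw j j.2
  have hl := hw l l.2
  have ci := succ_cases i
  have cj := succ_cases j
  have cl := succ_cases l
  rcases (cycleGraph_adj_iff_mod hm i j).1 hij with h | h <;>
    rcases (cycleGraph_adj_iff_mod hm j l).1 hjl with h' | h'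
  · have hne : i ≠ l := fun he ↦ by rw [Fin.ext_iff] at he; omega
    rw [h] at hi
    rw [h'] at hj
    refine ⟨_, hi, ?_⟩
    simp only [List.mem_cons, List.mem_flatMap, List.mem_filter]
    exact .inr (.inr ⟨_, ⟨hj, by simp⟩, by simp [hne]⟩)
  · have he : i = l := by rw [Fin.ext_iff]; omega
    subst he
    rw [h] at hi
    exact ⟨_, hi, by simp⟩
  · have he : i = l := by rw [Fin.ext_iff]; omega
    subst he
    rw [h] at hj
    exact ⟨_, hj, by simp⟩
  · have hne : i ≠ l := fun he ↦ by rw [Fin.ext_iff] at he; omega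
    rw [h'] at hl
    rw [h] at hj
    refine ⟨_, hl, ?_⟩
    simp only [List.mem_cons, List.mem_flatMap, List.mem_filter]
    exact .inr (.inr ⟨_, ⟨hj, by simp⟩, by simp [hne]⟩)

theorem HasClosedWalk.exists_mod (h : HasClosedWalk E m) :
    ∃ w : ℕ → ℕ, ∀ i < m, (w i, w ((i + 1) % m)) ∈ E := by
  obtain ⟨w, h0, hm, hw⟩ := h
  refine ⟨w, fun i hi ↦ ?_⟩
  rcases Nat.lt_or_ge (i + 1) m with h | h
  · rw [Nat.mod_eq_of_lt h]
    exact hw i hi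
  · obtain rfl : i + 1 = m := by omega
    rw [Nat.mod_self, h0, ← hm]
    exact hw i hi

theorem starColorable_of_table {n : ℕ} (hm : 3 ≤ m) (hn : 3 ≤ n)
    (h : isStarTable k F E₁ E₂ = true) (h₁ : HasClosedWalk E₁ m) (h₂ : HasClosedWalk E₂ n) :
    ((cycleGraph m).tensorProd (cycleGraph n)).StarColorable k := by
  obtain ⟨v, hv⟩ := h₁.exists_mod
  obtain ⟨w, hw⟩ := h₂.exists_mod
  have hlt (x : Fin m × Fin n) : F (v x.1) (w x.2) < k :=
    (isStarTable.step h (List.mem_flatMap.2 ⟨_, hv _ x.1.2, List.mem_cons_self⟩)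
      (List.mem_flatMap.2 ⟨_, hw _ x.2.2, List.mem_cons_self⟩)).1
  refine ⟨Coloring.mk (fun x ↦ ⟨F (v x.1) (w x.2), hlt x⟩) fun hab he ↦ ?_,
    (isStarColoring_iff _).2 fun a b c d hab hbc hcd hac hbd he he' ↦ ?_⟩
  · exact (isStarTable.step h (mem_arcSteps_of_adj hm hv hab.1)
      (mem_arcSteps_of_adj hn hw hab.2)).2 (Fin.ext_iff.1 he)
  · refine isStarTable.turn h (mem_arcTurns_of_adj hm hv hab.1 hbc.1)
      (mem_arcTurns_of_adj hn hw hab.2 hbc.2) (mem_arcTurns_of_adj hm hv hbc.1 hcd.1)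
      (mem_arcTurns_of_adj hn hw hbc.2 hcd.2) ?_ ?_ (Fin.ext_iff.1 he) (Fin.ext_iff.1 he')
    · rw [← Bool.decide_and, decide_eq_false_iff_not, ← Prod.ext_iff]
      exact hac
    · rw [← Bool.decide_and, decide_eq_false_iff_not, ← Prod.ext_iff]
      exact hbd

end Table

/-! ### Loop systems and explicit colour tables -/

/-- The colour at position `(x, y)` of a table given by its rows. -/
def tableEntry (T : List (List ℕ)) (x y : ℕ) : ℕ :=
  (T.getD x []).getD y 0

/-- Sums of 4, 5, 6 give every length from 4 on except 7. -/
def loops456 : List (List ℕ) := [[0, 1, 2, 3], [0, 1, 4, 5, 6], [0, 1, 7, 8, 9, 10]]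

def loops4567 : List (List ℕ) := loops456 ++ [[0, 1, 11, 12, 13, 14, 15]]

/-- For the factor multiplied by C₃, where 5 must be avoided. Sums of 4, 6, 7 miss 5 and 9, hence
the loop of length 9. As all loops share the path 0, 1, 2, any three consecutive arcs lie in one
loop. -/
def loops4679 : List (List ℕ) :=
  [[0, 1, 2, 3], [0, 1, 2, 4, 5, 6], [0, 1, 2, 7, 8, 9, 10],
    [0, 1, 2, 11, 12, 13, 14, 15, 16]]

def loops35 : List (List ℕ) := [[0, 1, 2], [0, 3, 4, 5, 6]]

theorem hasClosedWalk_loops456 {m : ℕ} (hm : 4 ≤ m) (h7 : m ≠ 7) :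
    HasClosedWalk (loopArcs loops456) m := by
  have h4 : HasClosedWalk (loopArcs loops456) 4 :=
    hasClosedWalk_of_loop [0, 1, 2, 3] (by decide) (by decide)
  have h5 : HasClosedWalk (loopArcs loops456) 5 :=
    hasClosedWalk_of_loop [0, 1, 4, 5, 6] (by decide) (by decide)
  have h6 : HasClosedWalk (loopArcs loops456) 6 :=
    hasClosedWalk_of_loop [0, 1, 7, 8, 9, 10] (by decide) (by decide)
  induction m using Nat.strong_induction_on with
  | _ m ih =>
    -- Subtracting 4 from 11 would hit the excluded 7, so the descent starts at 12.
    rcases Nat.lt_or_ge m 12 with h | h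
    · interval_cases m
      · exact h4
      · exact h5
      · exact h6
      · exact absurd rfl h7
      · exact h4.add h4
      · exact h4.add h5
      · exact h4.add h6
      · exact h5.add h6
    · simpa [show m - 4 + 4 = m by omega] using
        (ih (m - 4) (by omega) (by omega) (by omega)).add h4

theorem hasClosedWalk_loops4567 {n : ℕ} (hn : 4 ≤ n) :
    HasClosedWalk (loopArcs loops4567) n := by
  have h4 : HasClosedWalk (loopArcs loops4567) 4 :=
    hasClosedWalk_of_loop [0, 1, 2, 3] (by decide) (by decide)
  have h5 : HasClosedWalk (loopArcs loops4567) 5 :=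
    hasClosedWalk_of_loop [0, 1, 4, 5, 6] (by decide) (by decide)
  have h6 : HasClosedWalk (loopArcs loops4567) 6 :=
    hasClosedWalk_of_loop [0, 1, 7, 8, 9, 10] (by decide) (by decide)
  have h7 : HasClosedWalk (loopArcs loops4567) 7 :=
    hasClosedWalk_of_loop [0, 1, 11, 12, 13, 14, 15] (by decide) (by decide)
  induction n using Nat.strong_induction_on with
  | _ n ih =>
    rcases Nat.lt_or_ge n 8 with h | h
    · interval_cases n
      exacts [h4, h5, h6, h7]
    · simpa [show n - 4 + 4 = n by omega] using (ih (n - 4) (by omega) (by omega)).add h4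

theorem hasClosedWalk_loops4679 {n : ℕ} (hn : 4 ≤ n) (h5 : n ≠ 5) :
    HasClosedWalk (loopArcs loops4679) n := by
  have h4 : HasClosedWalk (loopArcs loops4679) 4 :=
    hasClosedWalk_of_loop [0, 1, 2, 3] (by decide) (by decide)
  have h6 : HasClosedWalk (loopArcs loops4679) 6 :=
    hasClosedWalk_of_loop [0, 1, 2, 4, 5, 6] (by decide) (by decide)
  have h7 : HasClosedWalk (loopArcs loops4679) 7 :=
    hasClosedWalk_of_loop [0, 1, 2, 7, 8, 9, 10] (by decide) (by decide)
  have h9 : HasClosedWalk (loopArcs loops4679) 9 :=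
    hasClosedWalk_of_loop [0, 1, 2, 11, 12, 13, 14, 15, 16] (by decide) (by decide)
  induction n using Nat.strong_induction_on with
  | _ n ih =>
    -- 9 is the length from which subtracting 4 hits the excluded 5.
    rcases eq_or_ne n 9 with rfl | hn9
    · exact h9
    · rcases Nat.lt_or_ge n 8 with h | h
      · interval_cases n
        exacts [h4, absurd rfl h5, h6, h7]
      · simpa [show n - 4 + 4 = n by omega] using
          (ih (n - 4) (by omega) (by omega) (by omega)).add h4

/-- With a single loop, the table is an ordinary colouring indexed by position along the cycle. -/
theorem hasClosedWalk_range (m : ℕ) : HasClosedWalk (loopArcs [List.range (m + 1)]) (m + 1) := by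
  have h := hasClosedWalk_of_loop (E := loopArcs [List.range (m + 1)]) (List.range (m + 1)) (by simp)
    (fun i hi ↦ by
      rw [loopArcs, List.flatMap_singleton, List.mem_iff_getElem]
      refine ⟨i, by simpa using hi, ?_⟩
      rw [List.length_range] at hi
      rcases Nat.lt_or_ge (i + 1) (m + 1) with h | h
      · simp [List.getElem_rotate, Nat.mod_eq_of_lt h, h, hi]
      · obtain rfl : i = m := by omega
        simp [List.getElem_rotate])
  simpa using h

theorem starColorable_five_of_ne_seven {m n : ℕ} (hm : 4 ≤ m) (h7 : m ≠ 7) (hn : 4 ≤ n) :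
    ((cycleGraph m).tensorProd (cycleGraph n)).StarColorable 5 :=
  starColorable_of_table (F := tableEntry
    [[4, 2, 2, 1, 2, 3, 1, 2, 3, 3, 1, 2, 4, 0, 3, 1],
      [3, 0, 3, 0, 1, 0, 0, 1, 4, 0, 2, 3, 1, 2, 2, 2],
      [1, 0, 3, 4, 3, 2, 4, 3, 2, 3, 4, 3, 1, 0, 0, 4],
      [3, 0, 3, 0, 4, 0, 0, 4, 1, 0, 0, 3, 4, 2, 3, 2],
      [1, 0, 3, 4, 3, 2, 4, 3, 2, 3, 4, 3, 1, 3, 0, 4],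
      [2, 2, 2, 2, 4, 2, 3, 4, 1, 0, 0, 2, 4, 2, 0, 2],
      [4, 3, 0, 1, 0, 0, 1, 0, 1, 2, 1, 0, 4, 1, 3, 1],
      [1, 0, 3, 4, 3, 2, 4, 3, 2, 0, 4, 3, 1, 4, 0, 4],
      [1, 0, 3, 4, 3, 2, 4, 3, 2, 0, 4, 3, 1, 3, 0, 4],
      [2, 2, 2, 2, 4, 2, 3, 4, 1, 3, 3, 2, 4, 2, 0, 2],
      [4, 3, 0, 1, 0, 0, 1, 0, 0, 2, 1, 0, 4, 1, 3, 1]])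
    (by omega) (by omega) (by decide +kernel) (hasClosedWalk_loops456 hm h7)
    (hasClosedWalk_loops4567 hn)

/-- Swapping the factors handles a single factor of length 7; only this case escapes the common
table. -/
theorem starColorable_five_seven_seven :
    ((cycleGraph 7).tensorProd (cycleGraph 7)).StarColorable 5 :=
  starColorable_of_table (F := tableEntry
    [[3, 0, 2, 2, 1, 0, 2], [1, 1, 3, 3, 1, 3, 2], [4, 4, 2, 4, 0, 4, 4], [0, 0, 2, 4, 0, 2, 3],
      [2, 1, 2, 3, 0, 1, 3], [4, 1, 2, 3, 0, 1, 3], [4, 0, 4, 4, 4, 4, 2]])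
    (by omega) (by omega) (by decide +kernel) (hasClosedWalk_range 6) (hasClosedWalk_range 6)

theorem starColorable_five_three {n : ℕ} (hn : 4 ≤ n) (h5 : n ≠ 5) :
    ((cycleGraph 3).tensorProd (cycleGraph n)).StarColorable 5 :=
  starColorable_of_table (F := tableEntry
    [[4, 0, 0, 0, 1, 3, 3, 1, 1, 3, 3, 4, 2, 0, 0, 4, 3],
      [1, 1, 2, 2, 4, 4, 2, 4, 4, 2, 2, 4, 2, 4, 1, 2, 2],
      [4, 3, 3, 3, 1, 0, 0, 3, 0, 0, 0, 1, 1, 3, 3, 4, 0]])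
    (by omega) (by omega) (by decide +kernel) (hasClosedWalk_range 2)
    (hasClosedWalk_loops4679 hn h5)

theorem starColorable_six_three {n : ℕ} (hn : n = 3 ∨ n = 5) :
    ((cycleGraph 3).tensorProd (cycleGraph n)).StarColorable 6 := by
  refine starColorable_of_table (F := tableEntry
    [[1, 2, 2, 2, 2, 4, 1], [0, 3, 5, 5, 5, 0, 0], [4, 3, 5, 3, 3, 3, 5]])
    (E₂ := loopArcs loops35) (by omega) (by omega) (by decide +kernel) (hasClosedWalk_range 2) ?_
  rcases hn with rfl | rfl
  · exact hasClosedWalk_of_loop [0, 1, 2] (by decide) (by decide)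
  · exact hasClosedWalk_of_loop [0, 3, 4, 5, 6] (by decide) (by decide)

theorem starColorable_five {m n : ℕ} (hm : 3 ≤ m) (hmn : m ≤ n) (h : ¬ (m = 3 ∧ (n = 3 ∨ n = 5))) :
    ((cycleGraph m).tensorProd (cycleGraph n)).StarColorable 5 := by
  rcases eq_or_ne m 3 with rfl | h3
  · exact starColorable_five_three (by omega) (by omega)
  rcases eq_or_ne m 7 with rfl | hm7
  · rcases eq_or_ne n 7 with rfl | hn7
    · exact starColorable_five_seven_seven
    · exact (starColorable_five_of_ne_seven (by omega) hn7 (by omega)).tensorProd_comm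
  · exact starColorable_five_of_ne_seven (by omega) hm7 (by omega)

/-! ### Refuting star colourings by exhaustive search -/

section Search

variable {V : Type*} {adj ne : V → V → Bool} {k : ℕ}

/-- `f` is proper for `adj`, and has no two-coloured walk on four vertices where vertices
at distance two on the walk are related by `ne`. -/
structure IsStarMap {α : Type*} (adj ne : V → V → Bool) (f : V → α) : Prop where
  proper : ∀ a b, adj a b = true → f a ≠ f b
  star : ∀ a b c d, adj a b = true → adj b c = true → adj c d = true → ne a c = true →
    ne b d = true → f a = f c → f b ≠ f d

theorem IsStarMap.comp {α β : Type*} {f : V → α} (hf : IsStarMap adj ne f) {g : α → β}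
    (hg : Function.Injective g) : IsStarMap adj ne (g ∘ f) :=
  ⟨fun a b h he ↦ hf.proper a b h (hg he), fun a b c d h₁ h₂ h₃ h₄ h₅ h₆ h₇ ↦
    hf.star a b c d h₁ h₂ h₃ h₄ h₅ (hg h₆) (hg h₇)⟩

/-- Giving the colour `c` to the vertex `v` is compatible with the colours listed in `s`. -/
def isStarExtension (adj ne : V → V → Bool) (s : List (V × ℕ)) (v : V) (c : ℕ) : Bool :=
  (s.filter fun b ↦ adj v b.1).all fun b ↦ !Nat.beq b.2 c &&
    ((s.all fun x ↦ !Nat.beq x.2 c || !adj b.1 x.1 || !ne v x.1 ||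
      s.all fun d ↦ !Nat.beq d.2 b.2 || !adj x.1 d.1 || !ne b.1 d.1) &&
    ((s.filter fun b ↦ adj v b.1).all fun a ↦ !Nat.beq a.2 b.2 || !ne a.1 b.1 ||
      s.all fun d ↦ !Nat.beq d.2 c || !adj b.1 d.1 || !ne v d.1))

/-- The colours listed in `s`, all less than `u`, extend to the vertices in the list, where the
colours from `u` on are taken in their order. -/
def starSearch (adj ne : V → V → Bool) (k : ℕ) : List V → ℕ → List (V × ℕ) → Bool
  | [], _, _ => true
  | v :: vs, u, s => (List.range (min (u + 1) k)).any fun c ↦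
      isStarExtension adj ne s v c && starSearch adj ne k vs (max u (c + 1)) ((v, c) :: s)

theorem IsStarMap.isStarExtension (hadj : ∀ a b, adj a b = adj b a) {f : V → ℕ}
    (hf : IsStarMap adj ne f) {s : List (V × ℕ)} (hs : ∀ p ∈ s, p.2 = f p.1) (v : V) :
    isStarExtension adj ne s v (f v) = true := by
  simp only [SimpleGraph.isStarExtension, List.all_eq_true, List.mem_filter, Bool.and_eq_true,
    Bool.or_eq_true, Bool.not_eq_true', ← Bool.not_eq_true, Nat.beq_eq]
  rintro b ⟨hb, hvb⟩
  refine ⟨?_, fun x hx ↦ ?_, ?_⟩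
  · rw [hs b hb]
    exact (hf.proper _ _ hvb).symm
  -- Here `v` is an end of the path `v, b, x, d`; the next case has it inside `a, v, b, d`.
  · by_contra! h
    obtain ⟨⟨⟨h1, h2⟩, h3⟩, d, hd, ⟨h4, h5⟩, h6⟩ := h
    rw [hs x hx] at h1
    rw [hs b hb, hs d hd] at h4
    exact hf.star v b.1 x.1 d.1 hvb h2 h5 h3 h6 h1.symm h4.symm
  · rintro a ⟨ha, hva⟩
    by_contra! h
    obtain ⟨⟨h1, h2⟩, d, hd, ⟨h3, h4⟩, h5⟩ := h
    rw [hs a ha, hs b hb] at h1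
    rw [hs d hd] at h3
    exact hf.star a.1 v b.1 d.1 (by rw [hadj, hva]) hvb h4 h2 h5 h1 h3.symm

/-- Soundness of the search: renaming colours by order of first appearance keeps a star colouring,
so some branch survives. -/
theorem IsStarMap.starSearch_of_perm (hadj : ∀ a b, adj a b = adj b a) {f : V → Fin k}
    (hf : IsStarMap adj ne f) (vs : List V) {u : ℕ} {s : List (V × ℕ)} (σ : Equiv.Perm (Fin k))
    (hs : ∀ p ∈ s, p.2 = σ (f p.1)) (hu : ∀ p ∈ s, p.2 < u) (huk : u ≤ k) :
    starSearch adj ne k vs u s = true := by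
  induction vs generalizing u s σ with
  | nil => rfl
  | cons v vs ih =>
    obtain ⟨τ, hτ, hτv⟩ : ∃ τ : Equiv.Perm (Fin k), (∀ p ∈ s, p.2 = τ (f p.1)) ∧
        (τ (f v)).val < u + 1 := by
      rcases Nat.lt_or_ge (σ (f v)).val u with h | h
      · exact ⟨σ, hs, h.trans (Nat.lt_succ_self u)⟩
      · have huk' : u < k := h.trans_lt (σ (f v)).2
        -- A new colour is swapped with `u`; the colours already used lie below `u` and stay fixed.
        refine ⟨σ.trans (Equiv.swap (σ (f v)) ⟨u, huk'⟩), fun p hp ↦ ?_, by simp⟩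
        have h1 := hs p hp
        have h2 := hu p hp
        rw [Equiv.trans_apply, Equiv.swap_apply_of_ne_of_ne, h1]
        · intro he
          rw [← he] at h
          omega
        · intro he
          rw [he] at h1
          simp only at h1
          omega
    rw [starSearch, List.any_eq_true]
    refine ⟨τ (f v), List.mem_range.2 (lt_min hτv (τ (f v)).2), ?_⟩
    rw [Bool.and_eq_true]
    constructor
    · exact (hf.comp (Fin.val_injective.comp τ.injective)).isStarExtension hadj hτ v
    · refine ih τ ?_ ?_ (by have := (τ (f v)).2; omega)
      · simpa using hτ
      · simp only [List.forall_mem_cons]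
        exact ⟨by omega, fun p hp ↦ (hu p hp).trans_le (le_max_left _ _)⟩

theorem IsStarMap.starSearch (hadj : ∀ a b, adj a b = adj b a) {f : V → Fin k}
    (hf : IsStarMap adj ne f) (vs : List V) : starSearch adj ne k vs 0 [] = true :=
  hf.starSearch_of_perm hadj vs 1 (by simp) (by simp) (Nat.zero_le k)

end Search

/-! ### Products of cycles as quotients of grids, and the lower bounds -/

/-- Adjacency of the residues of `i` and `j` in the cycle of length `m`
(in the path on the natural numbers if `m = 0`). -/
def modAdj (m i j : ℕ) : Bool :=
  Nat.beq ((i + 1) % m) (j % m) || Nat.beq ((j + 1) % m) (i % m)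

def torusAdj (m n : ℕ) (x y : ℕ × ℕ) : Bool :=
  modAdj m x.1 y.1 && modAdj n x.2 y.2

def torusNe (m n : ℕ) (x y : ℕ × ℕ) : Bool :=
  !(Nat.beq (x.1 % m) (y.1 % m) && Nat.beq (x.2 % n) (y.2 % n))

theorem torusAdj_comm (m n : ℕ) (x y : ℕ × ℕ) : torusAdj m n x y = torusAdj m n y x := by
  simp only [torusAdj, modAdj, Bool.or_comm]

section Torus

variable {m n M N : ℕ}

theorem cycleGraph_adj_of_modAdj (hm : 3 ≤ m) (hM : M = 0 ∨ M = m) {i j : ℕ}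
    (h : modAdj M i j = true) : (cycleGraph m).Adj ⟨i % m, Nat.mod_lt _ (by omega)⟩
      ⟨j % m, Nat.mod_lt _ (by omega)⟩ := by
  rw [cycleGraph_adj_iff_mod hm]
  simp only [modAdj, Bool.or_eq_true, Nat.beq_eq] at h
  simp only [Nat.mod_add_mod]
  rcases hM with rfl | rfl
  · simp only [Nat.mod_zero] at h
    rcases h with rfl | rfl <;> simp
  · exact h

/-- Since `m ≥ 3` does not divide 2, reduction modulo `m` never identifies distinct points two steps
apart; this lets colourings pull back to the grid. -/
theorem mod_eq_of_modAdj (hm : 3 ≤ m) (hM : M = 0 ∨ M = m) {i j l : ℕ}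
    (hij : modAdj M i j = true) (hjl : modAdj M j l = true) (h : i % m = l % m) :
    i % M = l % M := by
  rcases hM with rfl | rfl
  · simp only [modAdj, Bool.or_eq_true, Nat.beq_eq, Nat.mod_zero] at hij hjl ⊢
    have key (x : ℕ) : x % m ≠ (x + 2) % m := fun he ↦ by
      have := (Nat.modEq_iff_dvd' (Nat.le_add_right x 2)).1 he
      rw [Nat.add_sub_cancel_left] at this
      exact absurd (Nat.le_of_dvd (by norm_num) this) (by omega)
    rcases hij with rfl | rfl <;> rcases hjl with rfl | h'
    · exact absurd h (key i)
    · omega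
    · rfl
    · subst h'
      exact absurd h.symm (key l)
  · exact h

theorem StarColorable.starSearch {k : ℕ} (hm : 3 ≤ m) (hn : 3 ≤ n) (hM : M = 0 ∨ M = m)
    (hN : N = 0 ∨ N = n) (h : ((cycleGraph m).tensorProd (cycleGraph n)).StarColorable k)
    (vs : List (ℕ × ℕ)) : starSearch (torusAdj M N) (torusNe M N) k vs 0 [] = true := by
  obtain ⟨f, hf⟩ := h
  rw [isStarColoring_iff] at hf
  let φ (x : ℕ × ℕ) : Fin m × Fin n :=
    (⟨x.1 % m, Nat.mod_lt _ (by omega)⟩, ⟨x.2 % n, Nat.mod_lt _ (by omega)⟩)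
  have hφ {x y : ℕ × ℕ} (h : torusAdj M N x y = true) :
      ((cycleGraph m).tensorProd (cycleGraph n)).Adj (φ x) (φ y) := by
    rw [torusAdj, Bool.and_eq_true] at h
    exact And.intro (cycleGraph_adj_of_modAdj hm hM h.1) (cycleGraph_adj_of_modAdj hn hN h.2)
  have hne {x y z : ℕ × ℕ} (h : torusAdj M N x y = true) (h' : torusAdj M N y z = true)
      (hxz : torusNe M N x z = true) : φ x ≠ φ z := by
    rw [torusAdj, Bool.and_eq_true] at h h'
    intro he
    simp only [φ, Prod.mk.injEq, Fin.mk.injEq] at he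
    simp [torusNe, mod_eq_of_modAdj hm hM h.1 h'.1 he.1,
      mod_eq_of_modAdj hn hN h.2 h'.2 he.2] at hxz
  refine IsStarMap.starSearch (f := fun x ↦ f (φ x)) (torusAdj_comm M N)
    ⟨fun a b hab ↦ f.valid (hφ hab), fun a b c d hab hbc hcd hac hbd ↦ ?_⟩ vs
  exact hf _ _ _ _ (hφ hab) (hφ hbc) (hφ hcd) (hne hab hbc hac) (hne hbc hcd hbd)

/-- The vertices in the list form a 4 × 4 grid turned by 45 degrees. -/
theorem not_starColorable_four (hm : 3 ≤ m) (hn : 3 ≤ n) :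
    ¬ ((cycleGraph m).tensorProd (cycleGraph n)).StarColorable 4 := fun h ↦
  absurd (h.starSearch hm hn (.inl rfl) (.inl rfl)
    [(0, 3), (1, 2), (2, 1), (3, 0), (1, 4), (2, 3), (3, 2), (4, 1),
      (2, 5), (3, 4), (4, 3), (5, 2), (3, 6), (4, 5), (5, 4), (6, 3)]) (by decide +kernel)

theorem not_starColorable_five_three (hn : n = 3 ∨ n = 5) :
    ¬ ((cycleGraph 3).tensorProd (cycleGraph n)).StarColorable 5 := by
  intro h
  rcases hn with rfl | rfl
  · exact absurd (h.starSearch le_rfl le_rfl (.inr rfl) (.inr rfl)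
      [(2, 0), (1, 2), (0, 0), (1, 1), (0, 2), (2, 1), (1, 0), (2, 2), (0, 1)])
      (by decide +kernel)
  · exact absurd (h.starSearch le_rfl (by norm_num) (.inr rfl) (.inr rfl)
      [(2, 1), (2, 3), (0, 0), (1, 4), (2, 0), (1, 1), (0, 2), (1, 3), (0, 4), (2, 4), (1, 0),
        (1, 2), (0, 3), (2, 2), (0, 1)])
      (by decide +kernel)

end Torus

end SimpleGraph

theorem mainTheorem3 (m n : ℕ) (hm : 3 ≤ m) (hmn : m ≤ n) :
    ((SimpleGraph.cycleGraph m).tensorProd (SimpleGraph.cycleGraph n)).starChromaticNumber =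
      if m = 3 ∧ (n = 3 ∨ n = 5) then 6 else 5 := by
  split_ifs with h
  · obtain ⟨rfl, hn⟩ := h
    exact SimpleGraph.starChromaticNumber_eq_succ (SimpleGraph.starColorable_six_three hn)
      (SimpleGraph.not_starColorable_five_three hn)
  · exact SimpleGraph.starChromaticNumber_eq_succ (SimpleGraph.starColorable_five hm hmn h)
      (SimpleGraph.not_starColorable_four hm (hm.trans hmn))
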